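/- A dendrite is a locally connected continuum (compact connected metric space) containing no subset homeomorphic to the circle. For a continuous self-map $f$ of a compact metric space $(X,d)$, points $x,y\in X$ and $\delta>0$ put $$\Phi_{(f,x,y)}(\delta)=\liminf_{n\to\infty}\frac1n\#\{0\le k\le n: d(f^k(x),f^k(y))<\delta\},\qquad \Phi^*_{(f,x,y)}(\delta)=\limsup_{n\to\infty}\frac1n\#\{0\le k\le n: d(f^k(x),f^k(y))<\delta\}.$$ The pair $(x,y)$ is a DC2 pair if $\Phi^*_{(f,x,y)}(\delta)=1$ for every $0<\delta\le\operatorname{diam}X$ and $\Phi_{(f,x,y)}(\varepsilon)<1$ for some $0<\varepsilon\le\operatorname{diam}X$; it is a DC3 pair if there are $0\le a<b\le\operatorname{diam}X$ with $\Phi_{(f,x,y)}(\delta)<\Phi^*_{(f,x,y)}(\delta)$ for every $\delta\in(a,b)$. For $i\in\{2,3\}$, a set $S\subset X$ is a DC$i$ set if every pair of distinct points of $S$ is a DC$i$ pair. Theorem. There exist a dendrite $X$ and a continuous map $f:X\to X$ such that $(X,f)$ has an uncountable DC3 set but no DC2 pair. Consequently, for continuous self-maps of dendrites, the existence of a DC3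 pair does not imply the existence of a DC2 pair, and the existence of an uncountable DC3 set does not imply the existence of an uncountable DC2 set. -/

import Mathlib

open Filter

namespace DistChaos

/-- A dendrite: a locally connected continuum (compact connected metric space) that contains no
subset homeomorphic to the circle. -/
structure IsDendrite (X : Type*) [MetricSpace X] : Prop where
  compact : CompactSpace X
  connected : ConnectedSpace X
  locallyConnected : LocallyConnectedSpace X
  no_circle : ∀ S : Set X, IsEmpty (S ≃ₜ Circle)

section

variable {X : Type*} [MetricSpace X]

/-- The quotient `(1 / n) * #{0 ≤ k ≤ n ; d (f^k x, f^k y) < δ}`. -/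
noncomputable def closeFreq (f : X → X) (x y : X) (δ : ℝ) (n : ℕ) : ℝ :=
  (((Finset.range (n + 1)).filter (fun k => dist (f^[k] x) (f^[k] y) < δ)).card : ℝ) / (n : ℝ)

/-- The lower distribution function of the pair `(x, y)` generated by `f`. -/
noncomputable def lowerDist (f : X → X) (x y : X) (δ : ℝ) : ℝ :=
  liminf (closeFreq f x y δ) atTop

/-- The upper distribution function of the pair `(x, y)` generated by `f`. -/
noncomputable def upperDist (f : X → X) (x y : X) (δ : ℝ) : ℝ :=
  limsup (closeFreq f x y δ) atTop

/-- `(x, y)` is distributionally scrambled of type 2. -/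
def IsDC2Pair (f : X → X) (x y : X) : Prop :=
  (∀ δ : ℝ, 0 < δ → δ ≤ Metric.diam (Set.univ : Set X) → upperDist f x y δ = 1) ∧
    ∃ ε : ℝ, 0 < ε ∧ ε ≤ Metric.diam (Set.univ : Set X) ∧ lowerDist f x y ε < 1

/-- `(x, y)` is distributionally scrambled of type 3. -/
def IsDC3Pair (f : X → X) (x y : X) : Prop :=
  ∃ a b : ℝ, 0 ≤ a ∧ a < b ∧ b ≤ Metric.diam (Set.univ : Set X) ∧
    ∀ δ ∈ Set.Ioo a b, lowerDist f x y δ < upperDist f x y δ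

/-- `S` is a DC2 set: every pair of distinct points of `S` is a DC2 pair. -/
def IsDC2Set (f : X → X) (S : Set X) : Prop :=
  ∀ x ∈ S, ∀ y ∈ S, x ≠ y → IsDC2Pair f x y

/-- `S` is a DC3 set: every pair of distinct points of `S` is a DC3 pair. -/
def IsDC3Set (f : X → X) (S : Set X) : Prop :=
  ∀ x ∈ S, ∀ y ∈ S, x ≠ y → IsDC3Pair f x y

/-- There is a DC2 pair. -/
def HasDC2Pair (f : X → X) : Prop := ∃ x y : X, IsDC2Pair f x y

/-- There is a DC3 pair. -/
def HasDC3Pair (f : X → X) : Prop := ∃ x y : X, IsDC3Pair f x y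

/-- There is an uncountable DC2 set. -/
def HasUncountableDC2Set (f : X → X) : Prop := ∃ S : Set X, ¬ S.Countable ∧ IsDC2Set f S

/-- There is an uncountable DC3 set. -/
def HasUncountableDC3Set (f : X → X) : Prop := ∃ S : Set X, ¬ S.Countable ∧ IsDC3Set f S

end

end DistChaos

/-! The dynamics lives on the ends of a tree. An ultrametric compactum with gaps at most `1` is the
end space of a rooted tree of height `1`. If countably many gap values occur, this tree is a
dendrite (`isDendrite_tree`). A self-map of the ends that at most doubles gaps extends to the tree
by doubling depth below height `1` until the root is reached (`dist_pt_lowerHeight_le`). Every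
non-end then reaches the root in finite time, so only pairs of ends can be DC2.

The ends are pairs (label, sequence): the label is fixed, the sequence is shifted, and distances
between labels are scaled by `1` or `1 / 2` according to the current first entry. Over `blockSeq`,
two labels at distance `ρ` give orbits at distance `2ρ` or `ρ` on alternating blocks of lengths `3 *
4 ^ m`. The frequencies oscillate for thresholds in `(ρ, 2ρ)`, so all labels over `blockSeq` form a
DC3 set (`isDC3Pair_endPt`).

Different labels never come closer than `ρ`, which excludes DC2. For equal labels
(`not_isDC2Pair_endPt`), the subshift contains only shifts of `blockSeq` and eventually constant
sequences. Two shifts of `blockSeq` are close with density one. A shift and an eventually constant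
sequence are far apart with positive lower density. Two eventually constant sequences end up equal
or at distance `2`. -/

namespace DistChaos

/-- A continuous pseudo-ultrametric, bounded by `1`. -/
structure UnitUltrametric (K : Type*) [TopologicalSpace K] where
  /-- The distance function. -/
  gap : K → K → ℝ
  gap_self : ∀ x, gap x x = 0
  gap_comm : ∀ x y, gap x y = gap y x
  gap_le_one : ∀ x y, gap x y ≤ 1
  gap_le_max : ∀ x y z, gap x z ≤ max (gap x y) (gap y z)
  continuous_gap : Continuous fun p : K × K => gap p.1 p.2

/-! ### The tree of an ultrametric -/

section Tree

variable {K : Type*} [TopologicalSpace K] (U : UnitUltrametric K)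

theorem UnitUltrametric.gap_nonneg (x y : K) : 0 ≤ U.gap x y := by
  have h := U.gap_le_max x y x
  rwa [U.gap_self, U.gap_comm y x, max_self] at h

/-- The height at which the segments from the root to `(x, t)` and to `(y, s)` separate. -/
noncomputable def meetHeight (x : K) (t : unitInterval) (y : K) (s : unitInterval) : ℝ :=
  min (min (t : ℝ) s) (1 - U.gap x y)

/-- The disjoint union of the segments from the root to the ends of the tree of `U`. -/
def Branches (_U : UnitUltrametric K) : Type _ := K × unitInterval

/-- If the segments to `x` and `z` follow that to `y` up to heights `a` and `b`, they follow each
other up to `min a b`, by the ultrametric inequality. Since `max a b ≤ s`, the sum `a + b` is at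
most `s + min a b`. This is the triangle inequality of the tree. -/
theorem meetHeight_triangle (x y z : K) (t s r : unitInterval) :
    meetHeight U x t y s + meetHeight U y s z r ≤ s + meetHeight U x t z r := by
  have h := U.gap_le_max x y z
  unfold meetHeight
  have h1 : min (1 - U.gap x y) (1 - U.gap y z) ≤ 1 - U.gap x z := by
    rcases le_max_iff.1 h with h | h
    · exact (min_le_left _ _).trans (by linarith)
    · exact (min_le_right _ _).trans (by linarith)
  set a := min (min (t : ℝ) s) (1 - U.gap x y) with ha
  set b := min (min (s : ℝ) r) (1 - U.gap y z) with hb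
  have ha1 : a ≤ t := (min_le_left _ _).trans (min_le_left _ _)
  have ha2 : a ≤ s := (min_le_left _ _).trans (min_le_right _ _)
  have ha3 : a ≤ 1 - U.gap x y := min_le_right _ _
  have hb1 : b ≤ s := (min_le_left _ _).trans (min_le_left _ _)
  have hb2 : b ≤ r := (min_le_left _ _).trans (min_le_right _ _)
  have hb3 : b ≤ 1 - U.gap y z := min_le_right _ _
  have h2 : min a b ≤ min (min (t : ℝ) r) (1 - U.gap x z) :=
    le_min (le_min ((min_le_left _ _).trans ha1) ((min_le_right _ _).trans hb2))
      ((min_le_min ha3 hb3).trans h1)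
  rcases le_total a b with h3 | h3
  · rw [min_eq_left h3] at h2; linarith
  · rw [min_eq_right h3] at h2; linarith

/-- The distance is the length of the path down to the branching point and up again. It vanishes
between copies of a shared part of two segments, so the separation quotient glues them. -/
noncomputable instance : PseudoMetricSpace (Branches U) where
  dist p q := p.2 + q.2 - 2 * meetHeight U p.1 p.2 q.1 q.2
  dist_self p := by
    have := p.2.2.2
    simp only [meetHeight, U.gap_self, min_self, sub_zero]
    rw [min_eq_left this]; ring
  dist_comm p q := by
    simp only [meetHeight, U.gap_comm p.1 q.1, min_comm (p.2 : ℝ)]; ring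
  dist_triangle p q r := by
    have := meetHeight_triangle U p.1 q.1 r.1 p.2 q.2 r.2
    linarith

/-- The tree whose space of ends is the ultrametric space `U`. -/
abbrev Tree : Type _ := SeparationQuotient (Branches U)

/-- The point of height `t` on the segment from the root to the end `x`. -/
noncomputable def pt (x : K) (t : unitInterval) : Tree U :=
  SeparationQuotient.mk (show Branches U from (x, t))

theorem exists_pt (p : Tree U) : ∃ x t, p = pt U x t := by
  obtain ⟨q, rfl⟩ := SeparationQuotient.surjective_mk p
  exact ⟨q.1, q.2, rfl⟩

theorem dist_pt (x y : K) (t s : unitInterval) :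
    dist (pt U x t) (pt U y s) = t + s - 2 * min (min (t : ℝ) s) (1 - U.gap x y) := rfl

theorem dist_pt_self (x : K) (t s : unitInterval) :
    dist (pt U x t) (pt U x s) = |(t : ℝ) - s| := by
  rw [dist_pt, U.gap_self, sub_zero, min_eq_left ((min_le_left _ _).trans t.2.2)]
  rcases le_total (t : ℝ) s with h | h
  · rw [min_eq_left h, abs_of_nonpos (by linarith)]; ring
  · rw [min_eq_right h, abs_of_nonneg (by linarith)]; ring

theorem dist_pt_zero (x y : K) (t : unitInterval) : dist (pt U x t) (pt U y 0) = t := by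
  have h1 := U.gap_le_one x y
  have h2 := t.2.1
  rw [dist_pt]
  simp [h2, h1]

theorem dist_pt_one_one (x y : K) : dist (pt U x 1) (pt U y 1) = 2 * U.gap x y := by
  have h1 := U.gap_nonneg x y
  rw [dist_pt]
  simp [h1]; ring

theorem pt_zero (x y : K) : pt U x 0 = pt U y 0 := by
  rw [← dist_eq_zero, dist_pt_zero]; rfl

theorem continuous_pt : Continuous fun p : K × unitInterval => pt U p.1 p.2 := by
  rw [continuous_iff_continuous_dist]
  simp only [dist_pt]
  have := U.continuous_gap
  have h : Continuous fun p : (K × unitInterval) × (K × unitInterval) => U.gap p.1.1 p.2.1 :=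
    this.comp (f := fun p : (K × unitInterval) × (K × unitInterval) => (p.1.1, p.2.1))
      (by fun_prop)
  fun_prop

theorem compactSpace_tree [CompactSpace K] : CompactSpace (Tree U) := by
  have h : Function.Surjective fun p : K × unitInterval => pt U p.1 p.2 := fun p => by
    obtain ⟨x, t, rfl⟩ := exists_pt U p
    exact ⟨(x, t), rfl⟩
  exact ⟨h.range_eq ▸ isCompact_range (continuous_pt U)⟩

theorem isPreconnected_segment (x : K) (a b : unitInterval) :
    IsPreconnected (pt U x '' Set.Icc a b) :=
  isPreconnected_Icc.image _
    ((continuous_pt U).comp (f := fun t => (x, t)) (by fun_prop)).continuousOn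

/-- The path from the centre to a point of the ball, through their branching point `m`, stays in the
ball. This yields both connectedness and local connectedness. -/
theorem isPreconnected_ball (p : Tree U) (r : ℝ) : IsPreconnected (Metric.ball p r) := by
  rcases le_or_gt r 0 with hr | hr
  · rw [Metric.ball_eq_empty.2 hr]; exact isPreconnected_empty
  obtain ⟨x, t, rfl⟩ := exists_pt U p
  refine isPreconnected_of_forall (pt U x t) fun q hq => ?_
  obtain ⟨y, s, rfl⟩ := exists_pt U q
  rw [Metric.mem_ball, dist_comm, dist_pt] at hq
  have hg0 := U.gap_nonneg x y
  have hg1 := U.gap_le_one x y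
  set μ : ℝ := min (min (t : ℝ) s) (1 - U.gap x y) with hμ
  have h1 : μ ≤ t := (min_le_left _ _).trans (min_le_left _ _)
  have h2 : μ ≤ s := (min_le_left _ _).trans (min_le_right _ _)
  have h3 : μ ≤ 1 - U.gap x y := min_le_right _ _
  have h0 : 0 ≤ μ := le_min (le_min t.2.1 s.2.1) (by linarith)
  let m : unitInterval := ⟨μ, h0, h1.trans t.2.2⟩
  have hm : pt U x m = pt U y m := by
    rw [← dist_eq_zero, dist_pt, min_self]
    change μ + μ - 2 * min μ _ = 0
    rw [min_eq_left h3]; ring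
  refine ⟨pt U x '' Set.Icc m t ∪ pt U y '' Set.Icc m s, ?_, ?_, ?_, ?_⟩
  · rintro _ (⟨τ, ⟨hτ1, hτ2⟩, rfl⟩ | ⟨τ, ⟨hτ1, hτ2⟩, rfl⟩)
    · have hτ1' : μ ≤ τ := hτ1
      have hτ2' : (τ : ℝ) ≤ t := hτ2
      rw [Metric.mem_ball, dist_pt_self, abs_of_nonpos (by linarith)]
      linarith
    · have hτ1' : μ ≤ τ := hτ1
      have hτ2' : (τ : ℝ) ≤ s := hτ2
      have : μ ≤ min (min (τ : ℝ) t) (1 - U.gap y x) := by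
        rw [U.gap_comm y x]; exact le_min (le_min hτ1' h1) h3
      rw [Metric.mem_ball, dist_pt]
      linarith
  · exact Or.inl ⟨t, ⟨h1, le_rfl⟩, rfl⟩
  · exact Or.inr ⟨s, ⟨h2, le_rfl⟩, rfl⟩
  · exact IsPreconnected.union (pt U x m) ⟨m, ⟨le_rfl, h1⟩, rfl⟩ ⟨m, ⟨le_rfl, h2⟩, hm.symm⟩
      (isPreconnected_segment U x m t) (isPreconnected_segment U y m s)

theorem locallyConnectedSpace_tree : LocallyConnectedSpace (Tree U) :=
  locallyConnectedSpace_of_connected_bases (fun p r => Metric.ball p r) (fun _ r => 0 < r)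
    (fun _ => Metric.nhds_basis_ball) fun p r _ => isPreconnected_ball U p r

theorem connectedSpace_tree [Nonempty K] : ConnectedSpace (Tree U) := by
  obtain ⟨x⟩ := ‹Nonempty K›
  have h : Metric.ball (pt U x 0) 2 = Set.univ := by
    ext q
    obtain ⟨y, s, rfl⟩ := exists_pt U q
    rw [Metric.mem_ball, dist_pt_zero]
    have := s.2.2
    simp only [Set.mem_univ, iff_true]
    linarith
  have : PreconnectedSpace (Tree U) := ⟨h ▸ isPreconnected_ball U _ _⟩
  exact { toNonempty := ⟨pt U x 0⟩ }

/-! ### Absence of circles -/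

/-- A continuous function on the circle takes every intermediate value at least twice. -/
theorem Circle.exists_ne_of_lt_of_lt {g : Circle → ℝ} (hg : Continuous g) {a b : Circle} {c : ℝ}
    (ha : g a < c) (hb : c < g b) : ∃ z w, z ≠ w ∧ g z = c ∧ g w = c := by
  obtain ⟨α, rfl⟩ := Circle.exp_surjective a
  obtain ⟨β, ⟨hβ1, hβ2⟩, rfl⟩ : ∃ β ∈ Set.Ico α (α + 2 * Real.pi), Circle.exp β = b := by
    obtain ⟨β, rfl⟩ := Circle.exp_surjective b
    obtain ⟨γ, hγ, h⟩ := Circle.periodic_exp.exists_mem_Ico Real.two_pi_pos β α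
    exact ⟨γ, hγ, h.symm⟩
  have hG : Continuous fun θ => g (Circle.exp θ) := hg.comp Circle.exp.continuous
  -- The value `c` is attained once on each of the two open arcs between the points.
  obtain ⟨θ, ⟨h1, h2⟩, h3⟩ := intermediate_value_Ioo hβ1 hG.continuousOn ⟨ha, hb⟩
  obtain ⟨η, ⟨h4, h5⟩, h6⟩ := intermediate_value_Ioo' hβ2.le hG.continuousOn
    ⟨by rwa [Circle.exp_add_two_pi], hb⟩
  refine ⟨_, _, fun h => ?_, h3, h6⟩
  have := Circle.exp_injOn_Ico (a := α) (b := α + 2 * Real.pi) (by linarith)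
    ⟨h1.le, by linarith⟩ ⟨by linarith, h5⟩ h
  linarith

/-- The height at which `q` leaves the segment from the root to the end `x`. -/
noncomputable def heightAlong (x : K) (q : Tree U) : ℝ :=
  (dist q (pt U x 0) + 1 - dist q (pt U x 1)) / 2

theorem continuous_heightAlong (x : K) : Continuous (heightAlong U x) := by
  unfold heightAlong; fun_prop

theorem heightAlong_pt (x z : K) (r : unitInterval) :
    heightAlong U x (pt U z r) = min (r : ℝ) (1 - U.gap z x) := by
  have h : min (r : ℝ) ((1 : unitInterval) : ℝ) = r := min_eq_left r.2.2
  rw [heightAlong, dist_pt_zero, dist_pt, h]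
  simp only [Set.Icc.coe_one]
  ring

/-- At a height where nothing branches, the level set of `heightAlong` is a single point, whereas on
a circle every intermediate value is taken twice. Countably many gap values leave such a height
between the branching point and `t`. -/
theorem not_circle_of_meetHeight_lt (hV : (Set.range fun p : K × K => U.gap p.1 p.2).Countable)
    {S : Set (Tree U)} (e : S ≃ₜ Circle) {x y : K} {t s : unitInterval}
    (ha : pt U x t ∈ S) (hb : pt U y s ∈ S) (h : meetHeight U x t y s < t) : False := by
  have hc : ((fun v : ℝ => 1 - v) '' Set.range fun p : K × K => U.gap p.1 p.2).Countable :=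
    hV.image _
  obtain ⟨τ, hτ, h1, h2⟩ := (hc.dense_compl ℝ).exists_between h
  have hlev : ∀ q, heightAlong U x q = τ → ∀ q', heightAlong U x q' = τ → q = q' := by
    -- As `τ` is not a branching height, a point with this value has height `τ` and lies on the
    -- segment to `x`.
    have key : ∀ z r, heightAlong U x (pt U z r) = τ → (r : ℝ) = τ ∧ τ < 1 - U.gap z x := by
      intro z r hz
      rw [heightAlong_pt] at hz
      have hne : 1 - U.gap z x ≠ τ := fun h' => hτ ⟨_, ⟨(z, x), rfl⟩, h'⟩
      rcases min_choice (r : ℝ) (1 - U.gap z x) with h' | h'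
      · exact ⟨h' ▸ hz, lt_of_le_of_ne (hz ▸ min_le_right _ _) hne.symm⟩
      · exact absurd (h' ▸ hz) hne
    intro q hq q' hq'
    obtain ⟨z, r, rfl⟩ := exists_pt U q
    obtain ⟨z', r', rfl⟩ := exists_pt U q'
    obtain ⟨h3, h4⟩ := key z r hq
    obtain ⟨h5, h6⟩ := key z' r' hq'
    have h7 : τ ≤ 1 - U.gap z z' := by
      rcases le_max_iff.1 (U.gap_le_max z x z') with h | h
      · linarith
      · rw [U.gap_comm] at h; rw [U.gap_comm]; linarith [U.gap_comm z' z, U.gap_comm z' x]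
    rw [← dist_eq_zero, dist_pt, h3, h5, min_self, min_eq_left h7]; ring
  have hg : Continuous fun z => heightAlong U x (e.symm z : Tree U) :=
    (continuous_heightAlong U x).comp (continuous_subtype_val.comp e.symm.continuous)
  have hlo : heightAlong U x (e.symm (e ⟨_, hb⟩) : Tree U) < τ := by
    rw [e.symm_apply_apply, heightAlong_pt, U.gap_comm]
    unfold meetHeight at h1
    rcases min_lt_iff.1 h1 with h' | h'
    · rcases min_lt_iff.1 h' with h'' | h''
      · linarith
      · exact min_lt_of_left_lt h''
    · exact min_lt_of_right_lt h'
  have hhi : τ < heightAlong U x (e.symm (e ⟨_, ha⟩) : Tree U) := by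
    rw [e.symm_apply_apply, heightAlong_pt, U.gap_self, sub_zero, min_eq_left t.2.2]
    exact h2
  obtain ⟨z, w, hzw, hz, hw⟩ := Circle.exists_ne_of_lt_of_lt hg hlo hhi
  exact hzw (e.symm.injective (Subtype.ext (hlev _ hz _ hw)))

theorem isEmpty_homeomorph_circle
    (hV : (Set.range fun p : K × K => U.gap p.1 p.2).Countable) (S : Set (Tree U)) :
    IsEmpty (S ≃ₜ Circle) := by
  refine ⟨fun e => ?_⟩
  obtain ⟨a, b, hab⟩ : ∃ a b : S, a ≠ b :=
    ⟨e.symm (Circle.exp 0), e.symm (Circle.exp Real.pi), fun h => by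
      have := Circle.exp_injOn_Ico (a := 0) (b := 2 * Real.pi) (by linarith)
        ⟨le_rfl, Real.two_pi_pos⟩ ⟨Real.pi_pos.le, by linarith [Real.pi_pos]⟩
        (e.symm.injective h)
      exact Real.pi_pos.ne this⟩
  obtain ⟨a, ha⟩ := a
  obtain ⟨b, hb⟩ := b
  obtain ⟨x, t, rfl⟩ := exists_pt U a
  obtain ⟨y, s, rfl⟩ := exists_pt U b
  by_cases h : meetHeight U x t y s < t
  · exact not_circle_of_meetHeight_lt U hV e ha hb h
  by_cases h' : meetHeight U y s x t < s
  · exact not_circle_of_meetHeight_lt U hV e hb ha h'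
  refine hab (Subtype.ext ?_)
  have h1 : meetHeight U x t y s = meetHeight U y s x t := by
    simp only [meetHeight, U.gap_comm x y, min_comm (t : ℝ)]
  have h2 : dist (pt U x t) (pt U y s) = t + s - 2 * meetHeight U x t y s := rfl
  change pt U x t = pt U y s
  rw [← dist_le_zero, h2]
  linarith

theorem isDendrite_tree [CompactSpace K] [Nonempty K]
    (hV : (Set.range fun p : K × K => U.gap p.1 p.2).Countable) : IsDendrite (Tree U) :=
  ⟨compactSpace_tree U, connectedSpace_tree U, locallyConnectedSpace_tree U,
    isEmpty_homeomorph_circle U hV⟩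

/-! ### The induced map of the tree -/

/-- The map `t ↦ max (2 t - 1) 0` of the unit interval. -/
noncomputable def lowerHeight (t : unitInterval) : unitInterval :=
  ⟨max (2 * (t : ℝ) - 1) 0, le_max_right _ _, max_le (by linarith [t.2.2]) zero_le_one⟩

theorem coe_lowerHeight (t : unitInterval) : (lowerHeight t : ℝ) = max (2 * (t : ℝ) - 1) 0 := rfl

theorem lowerHeight_one : lowerHeight 1 = 1 :=
  Subtype.ext (by rw [coe_lowerHeight]; norm_num)

/-- The depth `1 - t` doubles at each step until the root is reached. -/
theorem iterate_lowerHeight_le (t : unitInterval) (k : ℕ) :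
    (lowerHeight^[k] t : ℝ) ≤ max (1 - 2 ^ k * (1 - (t : ℝ))) 0 := by
  induction k with
  | zero => simp
  | succ k ih =>
    rw [Function.iterate_succ_apply', coe_lowerHeight]
    refine max_le ?_ (le_max_right _ _)
    rcases le_max_iff.1 ih with h | h
    · exact le_max_of_le_left (by rw [pow_succ]; linarith)
    · exact le_max_of_le_right (by linarith)

theorem eventually_iterate_lowerHeight_eq_zero {t : unitInterval} (ht : t ≠ 1) :
    ∀ᶠ k in atTop, lowerHeight^[k] t = 0 := by
  have h1 : 0 < 1 - (t : ℝ) := by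
    have := lt_of_le_of_ne t.2.2 fun h => ht (Subtype.ext h)
    linarith
  have h2 : Tendsto (fun k : ℕ => (2 : ℝ) ^ k * (1 - t)) atTop atTop :=
    (tendsto_pow_atTop_atTop_of_one_lt one_lt_two).atTop_mul_const h1
  filter_upwards [h2.eventually_ge_atTop 1] with k hk
  refine Subtype.ext (le_antisymm ((iterate_lowerHeight_le t k).trans ?_) (lowerHeight^[k] t).2.1)
  exact max_le (by simpa using hk) le_rfl

variable {U} {g : K → K} (hg : ∀ x y, U.gap (g x) (g y) ≤ 2 * U.gap x y)
include hg

/-- The depths of both points double, and that of the branching point at most doubles (`h4`);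
truncation at the root only shortens lengths (`h5`). The bound makes the map well defined on the
quotient and continuous. -/
theorem dist_pt_lowerHeight_le (x y : K) (t s : unitInterval) :
    dist (pt U (g x) (lowerHeight t)) (pt U (g y) (lowerHeight s))
      ≤ 2 * dist (pt U x t) (pt U y s) := by
  rw [dist_pt, dist_pt]
  have h1 : min (min (t : ℝ) s) (1 - U.gap x y) ≤ t := (min_le_left _ _).trans (min_le_left _ _)
  have h2 : min (min (t : ℝ) s) (1 - U.gap x y) ≤ s := (min_le_left _ _).trans (min_le_right _ _)
  have h3 : min (min (t : ℝ) s) (1 - U.gap x y) ≤ 1 - U.gap x y := min_le_right _ _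
  set μ := min (min (t : ℝ) s) (1 - U.gap x y)
  have hg' := hg x y
  have hg1 := U.gap_le_one (g x) (g y)
  have h4 : max (2 * μ - 1) 0 ≤
      min (min (lowerHeight t : ℝ) (lowerHeight s)) (1 - U.gap (g x) (g y)) := by
    rw [coe_lowerHeight, coe_lowerHeight]
    refine le_min (le_min (max_le_max (by linarith) le_rfl) (max_le_max (by linarith) le_rfl))
      (max_le (by linarith) (by linarith))
  have h5 : ∀ a : ℝ, μ ≤ a → max (2 * a - 1) 0 - max (2 * μ - 1) 0 ≤ 2 * (a - μ) := by
    intro a ha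
    rw [sub_le_iff_le_add]
    refine max_le ?_ ?_
    · linarith [le_max_left (2 * μ - 1) 0]
    · linarith [le_max_right (2 * μ - 1) 0]
  have h6 := h5 t h1
  have h7 := h5 s h2
  rw [coe_lowerHeight, coe_lowerHeight] at h4 ⊢
  linarith

/-- The self-map of the tree that acts as `g` on the ends and pushes all other points down. -/
noncomputable def treeMap : Tree U → Tree U :=
  SeparationQuotient.lift (fun p : Branches U => pt U (g p.1) (lowerHeight p.2)) fun p q h => by
    have h' : dist (pt U p.1 p.2) (pt U q.1 q.2) = 0 :=
      (Metric.inseparable_iff (x := p) (y := q)).1 h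
    have := dist_pt_lowerHeight_le hg p.1 q.1 p.2 q.2
    rw [h', mul_zero] at this
    exact dist_le_zero.1 this

theorem treeMap_pt (x : K) (t : unitInterval) :
    treeMap hg (pt U x t) = pt U (g x) (lowerHeight t) := rfl

theorem continuous_treeMap : Continuous (treeMap hg) := by
  refine (LipschitzWith.of_dist_le_mul (K := 2) fun p q => ?_).continuous
  obtain ⟨x, t, rfl⟩ := exists_pt U p
  obtain ⟨y, s, rfl⟩ := exists_pt U q
  exact dist_pt_lowerHeight_le hg x y t s

theorem iterate_treeMap_pt (k : ℕ) (x : K) (t : unitInterval) :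
    (treeMap hg)^[k] (pt U x t) = pt U (g^[k] x) (lowerHeight^[k] t) := by
  induction k generalizing x t with
  | zero => rfl
  | succ k ih => simp only [Function.iterate_succ_apply, treeMap_pt, ih]

theorem iterate_treeMap_pt_one (k : ℕ) (x : K) :
    (treeMap hg)^[k] (pt U x 1) = pt U (g^[k] x) 1 := by
  rw [iterate_treeMap_pt, Function.iterate_fixed lowerHeight_one]

end Tree

/-! ### The subshift and the labelled ultrametric -/

section Sequences

/-- The distance `2⁻ⁿ` between binary sequences whose first difference is at `n`. -/
noncomputable def prefixDist (x y : ℕ → Bool) : ℝ := PiNat.dist.dist x y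

theorem prefixDist_nonneg (x y : ℕ → Bool) : 0 ≤ prefixDist x y := PiNat.dist_nonneg x y

theorem prefixDist_le_one (x y : ℕ → Bool) : prefixDist x y ≤ 1 := PiNat.dist_le_one x y

theorem prefixDist_self (x : ℕ → Bool) : prefixDist x x = 0 := PiNat.dist_self x

theorem prefixDist_comm (x y : ℕ → Bool) : prefixDist x y = prefixDist y x := PiNat.dist_comm x y

theorem prefixDist_le_max (x y z : ℕ → Bool) :
    prefixDist x z ≤ max (prefixDist x y) (prefixDist y z) := PiNat.dist_triangle_nonarch x y z

theorem prefixDist_pos {x y : ℕ → Bool} (h : x ≠ y) : 0 < prefixDist x y :=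
  (prefixDist_nonneg x y).lt_of_ne fun h' => h (PiNat.eq_of_dist_eq_zero x y h'.symm)

theorem prefixDist_le_iff {x y : ℕ → Bool} {n : ℕ} :
    prefixDist x y ≤ (1 / 2) ^ n ↔ ∀ i < n, x i = y i := by
  rw [prefixDist, ← PiNat.mem_cylinder_iff_dist_le, PiNat.cylinder]
  simp [eq_comm]

theorem prefixDist_eq_zero_or (x y : ℕ → Bool) :
    prefixDist x y = 0 ∨ ∃ n : ℕ, prefixDist x y = (1 / 2) ^ n := by
  by_cases h : x = y
  · exact Or.inl (h ▸ prefixDist_self x)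
  · exact Or.inr ⟨_, PiNat.dist_eq_of_ne h⟩

theorem prefixDist_of_head_ne {x y : ℕ → Bool} (h : x 0 ≠ y 0) : prefixDist x y = 1 := by
  refine le_antisymm (prefixDist_le_one x y) (not_lt.1 fun h' => h ?_)
  exact PiNat.apply_eq_of_dist_lt (n := 0) (by simpa [prefixDist] using h') le_rfl

theorem continuous_prefixDist :
    Continuous fun p : (ℕ → Bool) × (ℕ → Bool) => prefixDist p.1 p.2 :=
  letI : MetricSpace (ℕ → Bool) := PiNat.metricSpace
  continuous_dist

/-- The shift of binary sequences. -/
def shift (y : ℕ → Bool) : ℕ → Bool := fun n => y (n + 1)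

theorem iterate_shift_apply (y : ℕ → Bool) (k n : ℕ) : shift^[k] y n = y (n + k) := by
  induction k generalizing n with
  | zero => rfl
  | succ k ih => rw [Function.iterate_succ_apply', shift, ih]; congr 1; omega

theorem prefixDist_shift_le (x y : ℕ → Bool) :
    prefixDist (shift x) (shift y) ≤ 2 * prefixDist x y := by
  rcases prefixDist_eq_zero_or x y with h | ⟨n, h⟩
  · by_cases hxy : x = y
    · rw [hxy, prefixDist_self, prefixDist_self]; norm_num
    · exact absurd h (prefixDist_pos hxy).ne'
  · cases n with
    | zero => rw [h]; linarith [prefixDist_le_one (shift x) (shift y)]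
    | succ n =>
      have := prefixDist_le_iff.1 h.le
      have h2 : prefixDist (shift x) (shift y) ≤ (1 / 2) ^ n :=
        prefixDist_le_iff.2 fun i hi => this (i + 1) (by omega)
      rw [h, pow_succ]; linarith

/-- The sequence that is constant on the blocks `[4 ^ m, 4 ^ (m + 1))`, alternating between
`false` and `true`. -/
def blockSeq : ℕ → Bool := fun k => (Nat.log 4 k).bodd

/-- Binary sequences that change their value at most once. -/
def AtMostOneSwitch (y : ℕ → Bool) : Prop := ∀ i j k, i ≤ j → j ≤ k → y i = y k → y j = y i

theorem AtMostOneSwitch.eventually_const {y : ℕ → Bool} (h : AtMostOneSwitch y) :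
    ∃ b N, ∀ k ≥ N, y k = b := by
  by_cases h0 : ∀ j, y j = y 0
  · exact ⟨y 0, 0, fun k _ => h0 k⟩
  · push Not at h0
    obtain ⟨j, hj⟩ := h0
    refine ⟨y j, j, fun k hk => ?_⟩
    have : y k ≠ y 0 := fun h' => hj (h 0 j k (Nat.zero_le _) hk h'.symm)
    revert this hj
    cases y k <;> cases y j <;> cases y 0 <;> simp

/-- The subshift of the iterates of `blockSeq` and the sequences with at most one switch. -/
def blockShift : Set (ℕ → Bool) := {y | (∃ m, y = shift^[m] blockSeq) ∨ AtMostOneSwitch y}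

theorem shift_mem_blockShift {y : ℕ → Bool} (hy : y ∈ blockShift) : shift y ∈ blockShift := by
  rcases hy with ⟨m, rfl⟩ | hy
  · exact Or.inl ⟨m + 1, (Function.iterate_succ_apply' _ _ _).symm⟩
  · exact Or.inr fun i j k hij hjk h => hy _ _ _ (by omega) (by omega) h

/-- The window from `i + m` to `k + m` has endpoint ratio below `4`, so it meets at most two blocks.
-/
theorem blockSeq_eq_of_le {m i j k : ℕ} (hij : i ≤ j) (hjk : j ≤ k) (hk : k < m)
    (h : blockSeq (i + m) = blockSeq (k + m)) : blockSeq (j + m) = blockSeq (i + m) := by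
  have h1 : Nat.log 4 (i + m) ≤ Nat.log 4 (j + m) := Nat.log_mono_right (by omega)
  have h2 : Nat.log 4 (j + m) ≤ Nat.log 4 (k + m) := Nat.log_mono_right (by omega)
  have h3 : Nat.log 4 (k + m) ≤ Nat.log 4 ((i + m) * 4) := Nat.log_mono_right (by omega)
  rw [Nat.log_mul_base (by norm_num) (by omega)] at h3
  rcases (by omega : Nat.log 4 (j + m) = Nat.log 4 (i + m) ∨
    Nat.log 4 (j + m) = Nat.log 4 (k + m)) with h4 | h4
  · rw [blockSeq, h4, blockSeq]
  · rw [h]; rw [blockSeq, h4, blockSeq]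

/-- If `y` switches twice before `k + 1`, only the shifts by `m ≤ k` can share that prefix. These
are finitely many, so a limit of them is one of them. -/
theorem isClosed_blockShift : IsClosed blockShift := by
  refine isClosed_of_closure_subset fun y hy => ?_
  by_contra hy'
  have hsw : ¬ AtMostOneSwitch y := fun h => hy' (Or.inr h)
  unfold AtMostOneSwitch at hsw
  push Not at hsw
  obtain ⟨i, j, k, hij, hjk, h1, h2⟩ := hsw
  have hU : IsOpen (PiNat.cylinder y (k + 1)) := PiNat.isOpen_cylinder _ y (k + 1)
  have h3 := hU.inter_closure ⟨PiNat.self_mem_cylinder y (k + 1), hy⟩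
  have hfin : ((fun m => shift^[m] blockSeq) '' Set.Iic k).Finite := (Set.finite_Iic k).image _
  have h4 : PiNat.cylinder y (k + 1) ∩ blockShift ⊆ (fun m => shift^[m] blockSeq) '' Set.Iic k := by
    rintro z ⟨hz, hz'⟩
    have ei : z i = y i := hz i (by omega)
    have ej : z j = y j := hz j (by omega)
    have ek : z k = y k := hz k (by omega)
    rcases hz' with ⟨m, rfl⟩ | hz'
    · refine ⟨m, Set.mem_Iic.2 (not_lt.1 fun hm => h2 ?_), rfl⟩
      rw [iterate_shift_apply] at ei ej ek
      rw [← ei, ← ej]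
      exact blockSeq_eq_of_le hij hjk hm (by rw [ei, ek, h1])
    · exact absurd (by rw [← ej, ← ei]; exact hz' i j k hij hjk (by rw [ei, ek, h1])) h2
  obtain ⟨m, -, hm⟩ := hfin.isClosed.closure_subset_iff.2 h4 h3
  exact hy' (Or.inl ⟨m, hm.symm⟩)

instance : CompactSpace blockShift := isCompact_iff_compactSpace.1 isClosed_blockShift.isCompact

/-- The scale of the labels of a sequence, depending on its first entry. -/
noncomputable def scale (b : Bool) : ℝ := if b then 1 else 1 / 2

theorem half_le_scale (b : Bool) : 1 / 2 ≤ scale b := by cases b <;> norm_num [scale]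

theorem scale_le_one (b : Bool) : scale b ≤ 1 := by cases b <;> norm_num [scale]

/-- Pairs of a label and an element of `blockShift`. The distance of two labels is scaled
according to the first entry of the sequences. -/
noncomputable def labelledUltrametric : UnitUltrametric ((ℕ → Bool) × blockShift) where
  gap p q := max (prefixDist (p.2 : ℕ → Bool) q.2)
    (scale ((p.2 : ℕ → Bool) 0) * prefixDist p.1 q.1)
  gap_self p := by simp [prefixDist_self]
  gap_comm p q := by
    rw [prefixDist_comm p.1, prefixDist_comm (p.2 : ℕ → Bool)]
    -- If the first entries differ, the sequences are at distance `1`, which dominates the label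
    -- term; the asymmetric choice of scale is then harmless.
    by_cases h : (p.2 : ℕ → Bool) 0 = (q.2 : ℕ → Bool) 0
    · rw [h]
    · have hs : ∀ b, scale b * prefixDist q.1 p.1 ≤ 1 := fun b =>
        mul_le_one₀ (scale_le_one b) (prefixDist_nonneg _ _) (prefixDist_le_one _ _)
      rw [prefixDist_of_head_ne (Ne.symm h), max_eq_left (hs _), max_eq_left (hs _)]
  gap_le_one p q := max_le (prefixDist_le_one _ _)
    (mul_le_one₀ (scale_le_one _) (prefixDist_nonneg _ _) (prefixDist_le_one _ _))
  gap_le_max p q r := by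
    have hs : ∀ b x y, scale b * prefixDist x y ≤ 1 := fun b x y =>
      mul_le_one₀ (scale_le_one b) (prefixDist_nonneg _ _) (prefixDist_le_one _ _)
    by_cases h : (p.2 : ℕ → Bool) 0 = (q.2 : ℕ → Bool) 0
    · have h1 := prefixDist_le_max (p.2 : ℕ → Bool) q.2 r.2
      have h2 := prefixDist_le_max p.1 q.1 r.1
      rw [← h]
      refine max_le ?_ ?_
      · exact h1.trans (max_le_max (le_max_left _ _) (le_max_left _ _))
      · have h0 : 0 ≤ scale ((p.2 : ℕ → Bool) 0) := by linarith [half_le_scale ((p.2 : ℕ → Bool) 0)]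
        refine (mul_le_mul_of_nonneg_left h2 h0).trans ?_
        rw [mul_max_of_nonneg _ _ h0]
        exact max_le_max (le_max_right _ _) (le_max_right _ _)
    · rw [prefixDist_of_head_ne h]
      exact (max_le (prefixDist_le_one _ _) (hs _ _ _)).trans
        ((le_max_left _ _).trans (le_max_left _ _))
  continuous_gap := by
    have h1 : Continuous fun p : ((ℕ → Bool) × blockShift) × ((ℕ → Bool) × blockShift) =>
        prefixDist (p.1.2 : ℕ → Bool) p.2.2 :=
      continuous_prefixDist.comp
        (f := fun p : ((ℕ → Bool) × blockShift) × ((ℕ → Bool) × blockShift) =>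
          ((p.1.2 : ℕ → Bool), (p.2.2 : ℕ → Bool))) (by fun_prop)
    have h2 : Continuous fun p : ((ℕ → Bool) × blockShift) × ((ℕ → Bool) × blockShift) =>
        prefixDist p.1.1 p.2.1 :=
      continuous_prefixDist.comp
        (f := fun p : ((ℕ → Bool) × blockShift) × ((ℕ → Bool) × blockShift) =>
          (p.1.1, p.2.1)) (by fun_prop)
    have h3 : Continuous scale := continuous_of_discreteTopology
    have h4 : Continuous fun p : ((ℕ → Bool) × blockShift) × ((ℕ → Bool) × blockShift) =>
        scale ((p.1.2 : ℕ → Bool) 0) := h3.comp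
        ((continuous_apply 0).comp (continuous_subtype_val.comp (by fun_prop)))
    exact h1.max (h4.mul h2)

theorem labelledUltrametric_gap (c d : ℕ → Bool) (y z : blockShift) :
    labelledUltrametric.gap (c, y) (d, z) =
      max (prefixDist (y : ℕ → Bool) z) (scale ((y : ℕ → Bool) 0) * prefixDist c d) := rfl

theorem countable_range_labelledUltrametric :
    (Set.range fun p : ((ℕ → Bool) × blockShift) × ((ℕ → Bool) × blockShift) =>
      labelledUltrametric.gap p.1 p.2).Countable := by
  have hV : (insert 0 (Set.range fun n : ℕ => (1 / 2 : ℝ) ^ n)).Countable :=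
    (Set.countable_range _).insert _
  refine hV.mono ?_
  have h1 : ∀ x y, prefixDist x y ∈ insert 0 (Set.range fun n : ℕ => (1 / 2 : ℝ) ^ n) := by
    intro x y
    rcases prefixDist_eq_zero_or x y with h | ⟨n, h⟩
    · exact Or.inl h
    · exact Or.inr ⟨n, h.symm⟩
  have h2 : ∀ b x y, scale b * prefixDist x y ∈
      insert 0 (Set.range fun n : ℕ => (1 / 2 : ℝ) ^ n) := by
    intro b x y
    rcases prefixDist_eq_zero_or x y with h | ⟨n, h⟩
    · exact Or.inl (by rw [h, mul_zero])
    · cases b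
      · exact Or.inr ⟨n + 1, by simp only [scale, h, pow_succ]; norm_num; ring⟩
      · exact Or.inr ⟨n, by simp [scale, h]⟩
  rintro _ ⟨⟨⟨c, y⟩, ⟨d, z⟩⟩, rfl⟩
  change max _ _ ∈ _
  rcases max_choice (prefixDist (y : ℕ → Bool) z) (scale ((y : ℕ → Bool) 0) * prefixDist c d)
    with h | h
  · rw [h]; exact h1 _ _
  · rw [h]; exact h2 _ _ _

/-- The shift on the second component. -/
def labelledShift (p : (ℕ → Bool) × blockShift) : (ℕ → Bool) × blockShift :=
  (p.1, ⟨shift p.2, shift_mem_blockShift p.2.2⟩)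

theorem iterate_labelledShift (k : ℕ) (c : ℕ → Bool) (y : blockShift) :
    ∃ h, labelledShift^[k] (c, y) = (c, ⟨shift^[k] y, h⟩) := by
  induction k with
  | zero => exact ⟨y.2, rfl⟩
  | succ k ih =>
    obtain ⟨h, ih⟩ := ih
    refine ⟨by rw [Function.iterate_succ_apply']; exact shift_mem_blockShift h, ?_⟩
    simp only [Function.iterate_succ_apply', ih, labelledShift]

/-- The shift at most doubles `prefixDist`, and the scale, lying in `[1 / 2, 1]`, changes by a
factor of at most `2`. -/
theorem gap_labelledShift_le (p q : (ℕ → Bool) × blockShift) :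
    labelledUltrametric.gap (labelledShift p) (labelledShift q)
      ≤ 2 * labelledUltrametric.gap p q := by
  obtain ⟨c, y⟩ := p
  obtain ⟨d, z⟩ := q
  rw [labelledUltrametric_gap, labelledShift, labelledShift, labelledUltrametric_gap]
  have h1 := prefixDist_shift_le y z
  have h2 := prefixDist_nonneg c d
  refine max_le (h1.trans ?_) ?_
  · linarith [le_max_left (prefixDist (y : ℕ → Bool) z) (scale ((y : ℕ → Bool) 0) * prefixDist c d)]
  · have h3 := le_max_right (prefixDist (y : ℕ → Bool) z)
      (scale ((y : ℕ → Bool) 0) * prefixDist c d)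
    have h4 := mul_le_mul_of_nonneg_right (half_le_scale ((y : ℕ → Bool) 0)) h2
    have h5 := mul_le_mul_of_nonneg_right (scale_le_one (shift (y : ℕ → Bool) 0)) h2
    change scale (shift (y : ℕ → Bool) 0) * prefixDist c d ≤ _
    linarith

end Sequences

/-! ### Distribution functions and criteria against DC2 -/

section Frequencies

variable {X : Type*} [MetricSpace X] {f : X → X} {x y : X} {δ : ℝ}

/-- The number of times up to `n` at which the orbits of `x` and `y` are at least `δ` apart. -/
noncomputable def farCount (f : X → X) (x y : X) (δ : ℝ) (n : ℕ) : ℕ :=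
  ((Finset.range (n + 1)).filter (fun k => ¬ dist (f^[k] x) (f^[k] y) < δ)).card

theorem closeFreq_eq (n : ℕ) :
    closeFreq f x y δ n = ((n + 1 : ℝ) - farCount f x y δ n) / n := by
  have h := Finset.card_filter_add_card_filter_not (s := Finset.range (n + 1))
    (fun k => dist (f^[k] x) (f^[k] y) < δ)
  rw [Finset.card_range] at h
  have h' : (((Finset.range (n + 1)).filter (fun k => dist (f^[k] x) (f^[k] y) < δ)).card : ℝ)
      + farCount f x y δ n = n + 1 := by exact_mod_cast h
  rw [closeFreq, ← h', add_sub_cancel_right]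

theorem closeFreq_nonneg (n : ℕ) : 0 ≤ closeFreq f x y δ n := by
  unfold closeFreq; positivity

theorem closeFreq_le_two (n : ℕ) : closeFreq f x y δ n ≤ 2 := by
  -- The bound is `2`, not `1`: there are `n + 1` times but the divisor is `n`. At `n = 0` the
  -- quotient is `0`.
  rw [closeFreq_eq]
  rcases Nat.eq_zero_or_pos n with rfl | hn
  · simp
  · have : (1 : ℝ) ≤ n := by exact_mod_cast hn
    rw [div_le_iff₀ (by linarith)]
    have : (0 : ℝ) ≤ farCount f x y δ n := by positivity
    linarith

theorem isBoundedUnder_le_closeFreq :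
    IsBoundedUnder (· ≤ ·) atTop (closeFreq f x y δ) :=
  isBoundedUnder_of ⟨2, closeFreq_le_two⟩

theorem isBoundedUnder_ge_closeFreq :
    IsBoundedUnder (· ≥ ·) atTop (closeFreq f x y δ) :=
  isBoundedUnder_of ⟨0, closeFreq_nonneg⟩

theorem upperDist_le {c : ℝ} (h : ∀ᶠ n in atTop, closeFreq f x y δ n ≤ c) :
    upperDist f x y δ ≤ c :=
  limsup_le_of_le isBoundedUnder_ge_closeFreq.isCoboundedUnder_le h

theorem le_upperDist {c : ℝ} (h : ∃ᶠ n in atTop, c ≤ closeFreq f x y δ n) :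
    c ≤ upperDist f x y δ :=
  le_limsup_of_frequently_le h isBoundedUnder_le_closeFreq

theorem lowerDist_le {c : ℝ} (h : ∃ᶠ n in atTop, closeFreq f x y δ n ≤ c) :
    lowerDist f x y δ ≤ c :=
  liminf_le_of_frequently_le h isBoundedUnder_ge_closeFreq

theorem one_le_lowerDist {u : ℕ → ℝ} (hu : Tendsto u atTop (nhds 0))
    (h : ∀ᶠ n in atTop, (farCount f x y δ n : ℝ) / n ≤ u n) : 1 ≤ lowerDist f x y δ := by
  have h1 : Tendsto (fun n => 1 - u n) atTop (nhds 1) := by simpa using hu.const_sub 1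
  rw [← h1.liminf_eq]
  refine liminf_le_liminf ?_ h1.isBoundedUnder_ge
    isBoundedUnder_le_closeFreq.isCoboundedUnder_ge
  filter_upwards [h, eventually_gt_atTop 0] with n hn hn0
  have hn0' : (0 : ℝ) < n := by exact_mod_cast hn0
  rw [closeFreq_eq]
  have : ((n + 1 : ℝ) - farCount f x y δ n) / n = 1 + 1 / n - farCount f x y δ n / n := by
    field_simp
  have h3 : 0 < 1 / (n : ℝ) := by positivity
  linarith

theorem one_le_lowerDist_of_eventually
    (h : ∀ᶠ k in atTop, dist (f^[k] x) (f^[k] y) < δ) : 1 ≤ lowerDist f x y δ := by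
  obtain ⟨N, hN⟩ := eventually_atTop.1 h
  refine one_le_lowerDist (tendsto_const_div_atTop_nhds_zero_nat (N : ℝ)) (.of_forall fun n => ?_)
  have : farCount f x y δ n ≤ N := by
    rw [← Finset.card_range N]
    refine Finset.card_le_card fun k hk => ?_
    rw [Finset.mem_filter] at hk
    exact Finset.mem_range.2 (not_le.1 fun h' => hk.2 (hN k h'))
  gcongr

theorem upperDist_lt_one_of_eventually
    (h : ∀ᶠ k in atTop, δ ≤ dist (f^[k] x) (f^[k] y)) : upperDist f x y δ < 1 := by
  obtain ⟨N, hN⟩ := eventually_atTop.1 h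
  refine (upperDist_le (c := 1 / 2) ?_).trans_lt (by norm_num)
  filter_upwards [(tendsto_const_div_atTop_nhds_zero_nat (N : ℝ)).eventually_le_const
    (by norm_num : (0 : ℝ) < 1 / 2)] with n hn
  refine le_trans ?_ hn
  have : ((Finset.range (n + 1)).filter (fun k => dist (f^[k] x) (f^[k] y) < δ)).card ≤ N := by
    rw [← Finset.card_range N]
    refine Finset.card_le_card fun k hk => ?_
    rw [Finset.mem_filter] at hk
    exact Finset.mem_range.2 (not_le.1 fun h' => (hN k h').not_gt hk.2)
  unfold closeFreq
  gcongr

theorem not_isDC2Pair_of_upperDist {δ₀ : ℝ} (h₀ : 0 < δ₀)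
    (h : ∀ δ, 0 < δ → δ ≤ δ₀ → upperDist f x y δ < 1) : ¬ IsDC2Pair f x y := by
  rintro ⟨h1, ε, hε, hε', -⟩
  exact (h (min ε δ₀) (lt_min hε h₀) (min_le_right _ _)).ne
    (h1 _ (lt_min hε h₀) ((min_le_left _ _).trans hε'))

theorem not_isDC2Pair_of_lowerDist (h : ∀ ε, 0 < ε → 1 ≤ lowerDist f x y ε) :
    ¬ IsDC2Pair f x y := by
  rintro ⟨-, ε, hε, -, h1⟩
  exact (h ε hε).not_gt h1

theorem IsDC2Pair.symm (h : IsDC2Pair f x y) : IsDC2Pair f y x := by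
  have : ∀ δ, closeFreq f x y δ = closeFreq f y x δ := fun δ => by
    funext n; simp only [closeFreq, dist_comm]
  simpa only [IsDC2Pair, upperDist, lowerDist, this] using h

theorem not_isDC2Pair_of_eventually_le_dist {δ₀ : ℝ} (h₀ : 0 < δ₀)
    (h : ∀ᶠ k in atTop, δ₀ ≤ dist (f^[k] x) (f^[k] y)) : ¬ IsDC2Pair f x y :=
  not_isDC2Pair_of_upperDist h₀ fun _ _ hδ =>
    upperDist_lt_one_of_eventually (h.mono fun _ hk => hδ.trans hk)

theorem not_isDC2Pair_of_eventually_eq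
    (h : ∀ᶠ k in atTop, f^[k] x = f^[k] y) : ¬ IsDC2Pair f x y :=
  not_isDC2Pair_of_lowerDist fun ε hε =>
    one_le_lowerDist_of_eventually (h.mono fun k hk => by rwa [hk, dist_self])

end Frequencies

/-! ### The example: DC3 pairs, and exclusion of DC2 pairs -/

section Example

/-- The dendrite of the labelled shift. -/
abbrev ShiftTree : Type := Tree labelledUltrametric

/-- The map of `ShiftTree` induced by the labelled shift. -/
noncomputable abbrev shiftTreeMap : ShiftTree → ShiftTree := treeMap gap_labelledShift_le

/-- The end of `ShiftTree` with label `c` and sequence `y`. -/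
noncomputable def endPt (c : ℕ → Bool) (y : blockShift) : ShiftTree :=
  pt labelledUltrametric (c, y) 1

theorem dist_iterate_endPt (c d : ℕ → Bool) (y z : blockShift) (k : ℕ) :
    dist (shiftTreeMap^[k] (endPt c y)) (shiftTreeMap^[k] (endPt d z)) =
      2 * max (prefixDist (shift^[k] y) (shift^[k] z))
        (scale ((y : ℕ → Bool) k) * prefixDist c d) := by
  obtain ⟨h1, h2⟩ := iterate_labelledShift k c y
  obtain ⟨h3, h4⟩ := iterate_labelledShift k d z
  rw [endPt, endPt, iterate_treeMap_pt_one, iterate_treeMap_pt_one, dist_pt_one_one, h2, h4,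
    labelledUltrametric_gap]
  simp only [iterate_shift_apply, zero_add]

theorem dist_iterate_endPt_same_label (c : ℕ → Bool) (y z : blockShift) (k : ℕ) :
    dist (shiftTreeMap^[k] (endPt c y)) (shiftTreeMap^[k] (endPt c z)) =
      2 * prefixDist (shift^[k] y) (shift^[k] z) := by
  rw [dist_iterate_endPt, prefixDist_self, mul_zero, max_eq_left (prefixDist_nonneg _ _)]

theorem dist_iterate_endPt_same_seq (c d : ℕ → Bool) (y : blockShift) (k : ℕ) :
    dist (shiftTreeMap^[k] (endPt c y)) (shiftTreeMap^[k] (endPt d y)) =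
      2 * (scale ((y : ℕ → Bool) k) * prefixDist c d) := by
  rw [dist_iterate_endPt, prefixDist_self, max_eq_right]
  exact mul_nonneg (by linarith [half_le_scale ((y : ℕ → Bool) k)]) (prefixDist_nonneg _ _)

theorem blockSeq_eq_of_mem {m k : ℕ} (h1 : 4 ^ m ≤ k) (h2 : k < 4 ^ (m + 1)) :
    blockSeq k = m.bodd := by
  rw [blockSeq, Nat.log_eq_of_pow_le_of_lt_pow h1 h2]

/-- The sequence `blockSeq` as a point of the subshift. -/
def blockPoint : blockShift := ⟨blockSeq, Or.inl ⟨0, rfl⟩⟩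

/-- The last block fills three quarters of the times below `4 ^ (m + 1)`; on an even block the
orbits are at distance `prefixDist c d`, on an odd one at twice that. -/
theorem closeFreq_ge_of_even {c d : ℕ → Bool} {δ : ℝ} (hδ : prefixDist c d < δ)
    {m : ℕ} (hm : m.bodd = false) :
    3 / 4 ≤ closeFreq shiftTreeMap (endPt c blockPoint) (endPt d blockPoint) δ
      (4 ^ (m + 1) - 1) := by
  have h0 : 1 ≤ 4 ^ m := Nat.one_le_pow _ _ (by norm_num)
  have h1 : 3 * 4 ^ m ≤ ((Finset.range (4 ^ (m + 1) - 1 + 1)).filter (fun k =>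
      dist (shiftTreeMap^[k] (endPt c blockPoint))
        (shiftTreeMap^[k] (endPt d blockPoint)) < δ)).card := by
    have : 3 * 4 ^ m = (Finset.Ico (4 ^ m) (4 ^ (m + 1))).card := by
      rw [Nat.card_Ico, pow_succ]; omega
    rw [this]
    refine Finset.card_le_card fun k hk => ?_
    rw [Finset.mem_Ico] at hk
    rw [Finset.mem_filter, Finset.mem_range, dist_iterate_endPt_same_seq]
    refine ⟨by omega, ?_⟩
    have hb : (blockPoint : ℕ → Bool) k = false := (blockSeq_eq_of_mem hk.1 hk.2).trans hm
    rw [hb, scale]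
    norm_num
    linarith
  have h2 : (3 * 4 ^ m : ℝ) ≤ (((Finset.range (4 ^ (m + 1) - 1 + 1)).filter (fun k =>
      dist (shiftTreeMap^[k] (endPt c blockPoint))
        (shiftTreeMap^[k] (endPt d blockPoint)) < δ)).card : ℝ) := by
    exact_mod_cast h1
  have h0' : (1 : ℝ) ≤ 4 ^ m := by exact_mod_cast h0
  have h3 : ((4 ^ (m + 1) - 1 : ℕ) : ℝ) = 4 * 4 ^ m - 1 := by
    rw [Nat.cast_sub (Nat.one_le_pow _ _ (by norm_num))]; push_cast; ring
  rw [closeFreq, h3, le_div_iff₀ (by linarith)]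
  linarith

theorem closeFreq_le_of_odd {c d : ℕ → Bool} {δ : ℝ} (hδ : δ < 2 * prefixDist c d)
    {m : ℕ} (hm : m.bodd = true) :
    closeFreq shiftTreeMap (endPt c blockPoint) (endPt d blockPoint) δ
      (4 ^ (m + 1) - 1) ≤ 1 / 2 := by
  have h0 : 1 ≤ 4 ^ m := Nat.one_le_pow _ _ (by norm_num)
  have h1 : 3 * 4 ^ m ≤ farCount shiftTreeMap (endPt c blockPoint) (endPt d blockPoint) δ
      (4 ^ (m + 1) - 1) := by
    have : 3 * 4 ^ m = (Finset.Ico (4 ^ m) (4 ^ (m + 1))).card := by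
      rw [Nat.card_Ico, pow_succ]; omega
    rw [this]
    refine Finset.card_le_card fun k hk => ?_
    rw [Finset.mem_Ico] at hk
    rw [Finset.mem_filter, Finset.mem_range, dist_iterate_endPt_same_seq]
    refine ⟨by omega, ?_⟩
    have hb : (blockPoint : ℕ → Bool) k = true := (blockSeq_eq_of_mem hk.1 hk.2).trans hm
    rw [hb, scale]
    simpa using hδ.le
  have h2 : (3 * 4 ^ m : ℝ) ≤ farCount shiftTreeMap (endPt c blockPoint) (endPt d blockPoint) δ
      (4 ^ (m + 1) - 1) := by
    exact_mod_cast h1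
  have h0' : (1 : ℝ) ≤ 4 ^ m := by exact_mod_cast h0
  have h3 : ((4 ^ (m + 1) - 1 : ℕ) : ℝ) = 4 * 4 ^ m - 1 := by
    rw [Nat.cast_sub (Nat.one_le_pow _ _ (by norm_num))]; push_cast; ring
  rw [closeFreq_eq, h3, div_le_iff₀ (by linarith)]
  linarith

theorem le_four_pow_sub_one {N m : ℕ} (h : N ≤ m) : N ≤ 4 ^ (m + 1) - 1 := by
  have : m + 1 < 4 ^ (m + 1) := Nat.lt_pow_self (by norm_num)
  omega

theorem isDC3Pair_endPt {c d : ℕ → Bool} (h : c ≠ d) :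
    IsDC3Pair shiftTreeMap (endPt c blockPoint) (endPt d blockPoint) := by
  have hpos := prefixDist_pos h
  refine ⟨prefixDist c d, 2 * prefixDist c d, hpos.le, by linarith, ?_, fun δ hδ => ?_⟩
  -- Time `4` opens the first `true` block; there the distance `2 * prefixDist c d` is attained, so
  -- the diameter is at least that.
  · have hb : (blockPoint : ℕ → Bool) 4 = true :=
      blockSeq_eq_of_mem (m := 1) (k := 4) (by norm_num) (by norm_num)
    have h4 := dist_iterate_endPt_same_seq c d blockPoint 4
    rw [hb, scale, if_pos rfl, one_mul] at h4
    have := compactSpace_tree labelledUltrametric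
    rw [← h4]
    exact Metric.dist_le_diam_of_mem isCompact_univ.isBounded (Set.mem_univ _) (Set.mem_univ _)
  · have hlo : lowerDist shiftTreeMap (endPt c blockPoint) (endPt d blockPoint) δ ≤ 1 / 2 :=
      lowerDist_le (frequently_atTop.2 fun N => ⟨_, le_four_pow_sub_one (by omega : N ≤ 2 * N + 1),
        closeFreq_le_of_odd hδ.2 (by simp)⟩)
    have hhi : 3 / 4 ≤ upperDist shiftTreeMap (endPt c blockPoint) (endPt d blockPoint) δ :=
      le_upperDist (frequently_atTop.2 fun N => ⟨_, le_four_pow_sub_one (by omega : N ≤ 2 * N),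
        closeFreq_ge_of_even hδ.1 (by simp)⟩)
    linarith

theorem hasUncountableDC3Set_shiftTreeMap : HasUncountableDC3Set shiftTreeMap := by
  refine ⟨Set.range fun c => endPt c blockPoint, fun hc => ?_, ?_⟩
  · have hinj : Function.Injective fun c => endPt c blockPoint := fun c d hcd => by
      by_contra hne
      have h0 := dist_iterate_endPt_same_seq c d blockPoint 0
      rw [show endPt c blockPoint = endPt d blockPoint from hcd, dist_self] at h0
      have := mul_pos (by linarith [half_le_scale ((blockPoint : ℕ → Bool) 0)] :
        0 < scale ((blockPoint : ℕ → Bool) 0)) (prefixDist_pos hne)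
      linarith
    have hcount : Countable (ℕ → Bool) := by
      have := hc.to_subtype
      exact (Set.rangeFactorization_injective.2 hinj).countable
    obtain ⟨e, he⟩ := exists_surjective_nat (ℕ → Bool)
    obtain ⟨n, hn⟩ := he fun k => !(e k k)
    simpa using congrFun hn n
  · rintro _ ⟨c, rfl⟩ _ ⟨d, rfl⟩ hne
    exact isDC3Pair_endPt fun h => hne (h ▸ rfl)

/-- Of any two consecutive blocks, one carries the value opposite to `b`; throughout it the first
entries differ and the distance is `2`. -/
theorem upperDist_lt_one_of_orbit_of_eventually_const {c : ℕ → Bool} {y z : blockShift}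
    {i N : ℕ} {b : Bool} (hy : (y : ℕ → Bool) = shift^[i] blockSeq)
    (hz : ∀ k ≥ N, (z : ℕ → Bool) k = b) {δ : ℝ} (hδ : δ ≤ 2) :
    upperDist shiftTreeMap (endPt c y) (endPt c z) δ < 1 := by
  -- At least `3 * 4 ^ m` far times among `n < 64 * 4 ^ m` leave `61 / 64`; the extra time `k = 0`
  -- adds `1 / n ≤ 1 / 64`.
  refine (upperDist_le (c := 62 / 64) ?_).trans_lt (by norm_num)
  have hfar : ∀ k ≥ N, blockSeq (k + i) ≠ b →
      ¬ dist (shiftTreeMap^[k] (endPt c y)) (shiftTreeMap^[k] (endPt c z)) < δ := by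
    intro k hk hne
    rw [dist_iterate_endPt_same_label, prefixDist_of_head_ne, not_lt]
    · linarith
    · rw [iterate_shift_apply, iterate_shift_apply, zero_add, hy, iterate_shift_apply, hz k hk]
      exact hne
  filter_upwards [eventually_ge_atTop (4 ^ (N + i + 2)), eventually_ge_atTop 64] with n hn hn64
  obtain ⟨m, hm1, hm2⟩ : ∃ m, 4 ^ (m + 2) ≤ n ∧ n < 4 ^ (m + 3) := by
    have h2 : N + i + 2 ≤ Nat.log 4 n := Nat.le_log_of_pow_le (by norm_num) hn
    refine ⟨Nat.log 4 n - 2, ?_, ?_⟩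
    · rw [Nat.sub_add_cancel (by omega)]
      exact Nat.pow_log_le_self 4 (by omega)
    · rw [show Nat.log 4 n - 2 + 3 = Nat.log 4 n + 1 by omega]
      exact Nat.lt_pow_succ_log_self (by norm_num) n
  have hNm : N + i ≤ 4 ^ m := by
    have h3 : N + i + 2 < m + 3 := (Nat.pow_lt_pow_iff_right (by norm_num)).1 (hn.trans_lt hm2)
    have h4 : m < 4 ^ m := Nat.lt_pow_self (by norm_num)
    omega
  obtain ⟨j, hj1, hj2, hjb⟩ : ∃ j, m ≤ j ∧ j ≤ m + 1 ∧ j.bodd ≠ b := by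
    by_cases hb : m.bodd = b
    · exact ⟨m + 1, by omega, le_rfl, by rw [Nat.bodd_succ, hb]; cases b <;> simp⟩
    · exact ⟨m, le_rfl, by omega, hb⟩
  have hj3 : 4 ^ m ≤ 4 ^ j := Nat.pow_le_pow_right (by norm_num) hj1
  have hj4 : 4 ^ j ≤ 4 ^ (m + 1) := Nat.pow_le_pow_right (by norm_num) hj2
  have hcard : 3 * 4 ^ m ≤ farCount shiftTreeMap (endPt c y) (endPt c z) δ n := by
    have : 3 * 4 ^ m ≤ (Finset.Ico (4 ^ j - i) (4 ^ (j + 1) - i)).card := by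
      rw [Nat.card_Ico, pow_succ]; omega
    refine this.trans (Finset.card_le_card fun k hk => ?_)
    rw [Finset.mem_Ico, pow_succ] at hk
    rw [Finset.mem_filter, Finset.mem_range]
    rw [pow_succ] at hj4 hm1
    rw [pow_succ] at hm1
    refine ⟨by omega, hfar k (by omega) ?_⟩
    rw [blockSeq_eq_of_mem (m := j) (by omega) (by rw [pow_succ]; omega)]
    exact hjb
  have hcard' : (3 * 4 ^ m : ℝ) ≤ farCount shiftTreeMap (endPt c y) (endPt c z) δ n := by
    exact_mod_cast hcard
  have hn' : (n : ℝ) < 4 ^ m * 64 := by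
    have : n < 4 ^ m * 64 := by rw [pow_add] at hm2; exact hm2
    exact_mod_cast this
  have hn0 : (64 : ℝ) ≤ n := by exact_mod_cast hn64
  rw [closeFreq_eq, div_le_iff₀ (by linarith)]
  linarith

/-- Bounds the density of windows of length `D` before the block boundaries `4 ^ m`, whose number
grows logarithmically. -/
theorem tendsto_natLog_add_div (D : ℕ) :
    Tendsto (fun n : ℕ => ((D * (Nat.log 4 (n + D) + 1) : ℕ) : ℝ) / n) atTop (nhds 0) := by
  have h1 : Tendsto (fun n : ℕ => Real.log ((n + D : ℕ) : ℝ) / ((n + D : ℕ) : ℝ)) atTop (nhds 0) :=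
    (Real.isLittleO_log_id_atTop.tendsto_div_nhds_zero.comp tendsto_natCast_atTop_atTop).comp
      (tendsto_add_atTop_nat D)
  have h2 : Tendsto (fun n : ℕ => (1 : ℝ) / n) atTop (nhds 0) :=
    tendsto_const_div_atTop_nhds_zero_nat 1
  have h3 : Tendsto (fun n : ℕ => D * (2 * (Real.log ((n + D : ℕ) : ℝ) / ((n + D : ℕ) : ℝ))
      + 1 / n)) atTop (nhds 0) := by
    simpa using ((h1.const_mul 2).add h2).const_mul (D : ℝ)
  refine squeeze_zero' (.of_forall fun n => by positivity) ?_ h3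
  filter_upwards [eventually_ge_atTop (D + 1)] with n hn
  have hn0 : (0 : ℝ) < n := by exact_mod_cast (by omega : 0 < n)
  have hnD : ((n + D : ℕ) : ℝ) ≤ 2 * n := by exact_mod_cast (by omega : n + D ≤ 2 * n)
  have hpos : (0 : ℝ) < ((n + D : ℕ) : ℝ) := by exact_mod_cast (by omega : 0 < n + D)
  have hlog : (Nat.log 4 (n + D) : ℝ) ≤ Real.log ((n + D : ℕ) : ℝ) := by
    have h4 : (4 : ℝ) ^ Nat.log 4 (n + D) ≤ ((n + D : ℕ) : ℝ) := by
      exact_mod_cast Nat.pow_log_le_self 4 (by omega)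
    have h5 := Real.log_le_log (by positivity) h4
    rw [Real.log_pow] at h5
    have h6 : (1 : ℝ) ≤ Real.log 4 := by
      rw [Real.le_log_iff_exp_le (by norm_num)]
      linarith [Real.exp_one_lt_d9]
    exact (le_mul_of_one_le_right (by positivity) h6).trans h5
  have hlog0 : (0 : ℝ) ≤ Real.log ((n + D : ℕ) : ℝ) := le_trans (by positivity) hlog
  have h7 : Real.log ((n + D : ℕ) : ℝ) / n ≤
      2 * (Real.log ((n + D : ℕ) : ℝ) / ((n + D : ℕ) : ℝ)) := by
    rw [← mul_div_assoc, div_le_div_iff₀ hn0 hpos]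
    calc _ ≤ Real.log ((n + D : ℕ) : ℝ) * (2 * n) := mul_le_mul_of_nonneg_left hnD hlog0
      _ = _ := by ring
  rw [Nat.cast_mul, mul_div_assoc, Nat.cast_add, Nat.cast_one, add_div]
  refine mul_le_mul_of_nonneg_left (add_le_add_left ?_ _) (by positivity)
  exact (div_le_div_of_nonneg_right hlog hn0.le).trans h7

/-- The first `L` entries at time `k` can differ only if some boundary `4 ^ m` lies in `(k + l + i,
k + l + j]` with `l < L`. Then `k` is within `L + j` below `4 ^ m`, and such times have density
zero. -/
theorem one_le_lowerDist_of_orbit_of_orbit {c : ℕ → Bool} {y z : blockShift} {i j : ℕ}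
    (hij : i ≤ j) (hy : (y : ℕ → Bool) = shift^[i] blockSeq)
    (hz : (z : ℕ → Bool) = shift^[j] blockSeq) {ε : ℝ} (hε : 0 < ε) :
    1 ≤ lowerDist shiftTreeMap (endPt c y) (endPt c z) ε := by
  obtain ⟨L, hL⟩ := exists_pow_lt_of_lt_one (half_pos hε) (by norm_num : (1 / 2 : ℝ) < 1)
  refine one_le_lowerDist (tendsto_natLog_add_div (L + j)) (.of_forall fun n => ?_)
  refine div_le_div_of_nonneg_right ?_ (Nat.cast_nonneg n)
  refine Nat.cast_le.2 ?_
  have hsub : ((Finset.range (n + 1)).filter (fun k =>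
      ¬ dist (shiftTreeMap^[k] (endPt c y)) (shiftTreeMap^[k] (endPt c z)) < ε)) ⊆
      (Finset.range (Nat.log 4 (n + (L + j)) + 1)).biUnion fun m =>
        Finset.Ico (4 ^ m - (L + j)) (4 ^ m) := by
    intro k hk
    rw [Finset.mem_filter, Finset.mem_range, dist_iterate_endPt_same_label] at hk
    obtain ⟨hk1, hk2⟩ := hk
    have hne : ¬ ∀ l < L, (shift^[k] (y : ℕ → Bool)) l = (shift^[k] (z : ℕ → Bool)) l := by
      intro h
      have := prefixDist_le_iff.2 h
      exact hk2 (by linarith)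
    push Not at hne
    obtain ⟨l, hl, hne⟩ := hne
    rw [iterate_shift_apply, iterate_shift_apply, hy, hz, iterate_shift_apply,
      iterate_shift_apply] at hne
    have hlt : Nat.log 4 (l + k + i) < Nat.log 4 (l + k + j) :=
      (Nat.log_mono_right (by omega)).lt_of_ne fun h => hne (by rw [blockSeq, blockSeq, h])
    have h0 : l + k + j ≠ 0 := fun h => by rw [h] at hlt; simp at hlt
    have h1 : 4 ^ Nat.log 4 (l + k + j) ≤ l + k + j := Nat.pow_log_le_self 4 h0
    have h2 : l + k + i < 4 ^ Nat.log 4 (l + k + j) := Nat.lt_pow_of_log_lt (by norm_num) hlt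
    have h3 : Nat.log 4 (l + k + j) ≤ Nat.log 4 (n + (L + j)) := Nat.log_mono_right (by omega)
    rw [Finset.mem_biUnion]
    exact ⟨Nat.log 4 (l + k + j), Finset.mem_range.2 (by omega),
      Finset.mem_Ico.2 ⟨by omega, by omega⟩⟩
  refine (Finset.card_le_card hsub).trans ?_
  refine (Finset.card_biUnion_le_card_mul _ _ (L + j) fun m _ => ?_).trans ?_
  · rw [Nat.card_Ico]; omega
  · rw [Finset.card_range, mul_comm]

/-- The scale never drops below `1 / 2`, so the orbits stay at least `prefixDist c d` apart. -/
theorem not_isDC2Pair_of_label_ne {c d : ℕ → Bool} (h : c ≠ d) (y z : blockShift) :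
    ¬ IsDC2Pair shiftTreeMap (endPt c y) (endPt d z) := by
  refine not_isDC2Pair_of_eventually_le_dist (prefixDist_pos h) (.of_forall fun k => ?_)
  rw [dist_iterate_endPt]
  have h1 := le_max_right (prefixDist (shift^[k] y) (shift^[k] z))
    (scale ((y : ℕ → Bool) k) * prefixDist c d)
  have h2 := mul_le_mul_of_nonneg_right (half_le_scale ((y : ℕ → Bool) k)) (prefixDist_nonneg c d)
  linarith

theorem not_isDC2Pair_of_orbit_of_atMostOneSwitch {c : ℕ → Bool} {y z : blockShift} {i : ℕ}
    (hy : (y : ℕ → Bool) = shift^[i] blockSeq) (hz : AtMostOneSwitch z) :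
    ¬ IsDC2Pair shiftTreeMap (endPt c y) (endPt c z) := by
  obtain ⟨b, N, hN⟩ := hz.eventually_const
  exact not_isDC2Pair_of_upperDist two_pos fun δ _ hδ =>
    upperDist_lt_one_of_orbit_of_eventually_const hy hN hδ

theorem not_isDC2Pair_of_atMostOneSwitch {c : ℕ → Bool} {y z : blockShift}
    (hy : AtMostOneSwitch y) (hz : AtMostOneSwitch z) :
    ¬ IsDC2Pair shiftTreeMap (endPt c y) (endPt c z) := by
  obtain ⟨a, M, hM⟩ := hy.eventually_const
  obtain ⟨b, N, hN⟩ := hz.eventually_const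
  by_cases hab : a = b
  · refine not_isDC2Pair_of_eventually_eq ?_
    filter_upwards [eventually_ge_atTop (max M N)] with k hk
    have : shift^[k] (y : ℕ → Bool) = shift^[k] z := by
      funext l
      rw [iterate_shift_apply, iterate_shift_apply, hM _ (by omega), hN _ (by omega), hab]
    rw [← dist_eq_zero, dist_iterate_endPt_same_label, this, prefixDist_self, mul_zero]
  · refine not_isDC2Pair_of_eventually_le_dist two_pos ?_
    filter_upwards [eventually_ge_atTop (max M N)] with k hk
    rw [dist_iterate_endPt_same_label, prefixDist_of_head_ne, mul_one]
    rwa [iterate_shift_apply, iterate_shift_apply, hM _ (by omega), hN _ (by omega)]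

theorem not_isDC2Pair_endPt (c d : ℕ → Bool) (y z : blockShift) :
    ¬ IsDC2Pair shiftTreeMap (endPt c y) (endPt d z) := by
  by_cases hcd : c = d
  · subst hcd
    rcases y.2 with ⟨i, hi⟩ | hy <;> rcases z.2 with ⟨j, hj⟩ | hz
    · rcases le_total i j with hij | hij
      · exact not_isDC2Pair_of_lowerDist fun ε hε =>
          one_le_lowerDist_of_orbit_of_orbit hij hi hj hε
      · exact fun h => not_isDC2Pair_of_lowerDist (fun ε hε =>
          one_le_lowerDist_of_orbit_of_orbit hij hj hi hε) h.symm
    · exact not_isDC2Pair_of_orbit_of_atMostOneSwitch hi hz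
    · exact fun h => not_isDC2Pair_of_orbit_of_atMostOneSwitch hj hy h.symm
    · exact not_isDC2Pair_of_atMostOneSwitch hy hz
  · exact not_isDC2Pair_of_label_ne hcd y z

/-- One orbit stays among the ends while the other settles at the root, at distance `1`. -/
theorem not_isDC2Pair_endPt_of_ne_one (p q : (ℕ → Bool) × blockShift) {t : unitInterval}
    (ht : t ≠ 1) :
    ¬ IsDC2Pair shiftTreeMap (pt labelledUltrametric p 1) (pt labelledUltrametric q t) := by
  refine not_isDC2Pair_of_eventually_le_dist one_pos ?_
  filter_upwards [eventually_iterate_lowerHeight_eq_zero ht] with k hk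
  rw [iterate_treeMap_pt_one, iterate_treeMap_pt, hk, dist_pt_zero]
  exact le_rfl

theorem not_hasDC2Pair_shiftTreeMap : ¬ HasDC2Pair shiftTreeMap := by
  rintro ⟨p, q, h⟩
  obtain ⟨x, t, rfl⟩ := exists_pt _ p
  obtain ⟨y, s, rfl⟩ := exists_pt _ q
  by_cases ht : t = 1 <;> by_cases hs : s = 1
  · subst ht hs
    exact not_isDC2Pair_endPt x.1 y.1 x.2 y.2 h
  · subst ht
    exact not_isDC2Pair_endPt_of_ne_one x y hs h
  · subst hs
    exact not_isDC2Pair_endPt_of_ne_one y x ht h.symm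
  · refine not_isDC2Pair_of_eventually_eq ?_ h
    filter_upwards [eventually_iterate_lowerHeight_eq_zero ht,
      eventually_iterate_lowerHeight_eq_zero hs] with k hk hk'
    rw [iterate_treeMap_pt, iterate_treeMap_pt, hk, hk']
    exact pt_zero _ _ _

theorem isDendrite_shiftTree : IsDendrite ShiftTree :=
  have : Nonempty ((ℕ → Bool) × blockShift) := ⟨(blockSeq, blockPoint)⟩
  isDendrite_tree _ countable_range_labelledUltrametric

end Example

/-! ### From uncountable sets to pairs -/

section Consequences

variable {X : Type*} [MetricSpace X] {f : X → X}

theorem exists_ne_of_not_countable {Y : Type*} {S : Set Y} (h : ¬ S.Countable) :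
    ∃ x ∈ S, ∃ y ∈ S, x ≠ y := by
  by_contra! hS
  exact h (Set.Subsingleton.countable fun x hx y hy => hS x hx y hy)

theorem HasUncountableDC3Set.hasDC3Pair (h : HasUncountableDC3Set f) : HasDC3Pair f := by
  obtain ⟨S, hS, h⟩ := h
  obtain ⟨x, hx, y, hy, hxy⟩ := exists_ne_of_not_countable hS
  exact ⟨x, y, h x hx y hy hxy⟩

theorem HasUncountableDC2Set.hasDC2Pair (h : HasUncountableDC2Set f) : HasDC2Pair f := by
  obtain ⟨S, hS, h⟩ := h
  obtain ⟨x, hx, y, hy, hxy⟩ := exists_ne_of_not_countable hS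
  exact ⟨x, y, h x hx y hy hxy⟩

end Consequences

end DistChaos

theorem mainTheorem2 :
    (∃ (X : Type) (_ : MetricSpace X) (f : X → X),
      DistChaos.IsDendrite X ∧ Continuous f ∧
        DistChaos.HasUncountableDC3Set f ∧ ¬ DistChaos.HasDC2Pair f) ∧
    (¬ ∀ (X : Type) (_ : MetricSpace X) (f : X → X),
      DistChaos.IsDendrite X → Continuous f →
        DistChaos.HasDC3Pair f → DistChaos.HasDC2Pair f) ∧
    (¬ ∀ (X : Type) (_ : MetricSpace X) (f : X → X),
      DistChaos.IsDendrite X → Continuous f →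
        DistChaos.HasUncountableDC3Set f → DistChaos.HasUncountableDC2Set f) := by
  have hf := DistChaos.continuous_treeMap DistChaos.gap_labelledShift_le
  have h3 := DistChaos.hasUncountableDC3Set_shiftTreeMap
  have h2 := DistChaos.not_hasDC2Pair_shiftTreeMap
  exact ⟨⟨_, _, _, DistChaos.isDendrite_shiftTree, hf, h3, h2⟩,
    fun h => h2 (h _ _ _ DistChaos.isDendrite_shiftTree hf h3.hasDC3Pair),
    fun h => h2 (h _ _ _ DistChaos.isDendrite_shiftTree hf h3).hasDC2Pair⟩
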